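/- Let $F:[0,\infty)\to[0,\infty)$ be a non-decreasing continuous function with $\lim_{x\to\infty}F(x)/x=\infty$. Let $m$ denote normalized Lebesgue measure on the unit circle $\mathbb{T}=\{z\in\mathbb{C}:|z|=1\}$. Then there exist a Borel probability measure $\sigma$ on $\mathbb{T}$ satisfying the Szegő condition $$\int_{\mathbb{T}}\log\sigma'\,dm>-\infty,$$ where $\sigma'$ is the density of the absolutely continuous part of $\sigma$ with respect to $m$ (with $\log 0=-\infty$; the singular part of $\sigma$ is arbitrary), and a strictly increasing sequence of natural numbers $M_1<M_2<\cdots$ such that $$\int_{\mathbb{T}}F\bigl(|\Phi_{M_k}(z)|^2\bigr)\,d\sigma(z)\to\infty\qquad(k\to\infty),$$ where $\Phi_n$ is the $n$-th monic orthogonal polynomial of $\sigma$, i.e. the monic polynomial of degree $n$ with $\int_{\mathbb{T}}\overline{z^{k}}\,\Phi_n(z)\,d\sigma(z)=0$ for all $0\le k<n$. -/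

import Mathlib

open MeasureTheory Filter
open scoped NNReal ENNReal ComplexConjugate Polynomial

namespace OPUC

/-- The unit circle carries its Borel `σ`-algebra. -/
noncomputable instance : MeasurableSpace Circle := borel Circle

instance : BorelSpace Circle := ⟨rfl⟩

/-- Normalized Lebesgue measure `dm = dθ / 2π` on the unit circle, as the image of
`dθ / 2π` on `(-π, π]` under `θ ↦ exp (i θ)`. -/
noncomputable def circleLebesgue : Measure Circle :=
  ENNReal.ofReal (1 / (2 * Real.pi)) •
    (volume.restrict (Set.Ioc (-Real.pi) Real.pi)).map Circle.exp

/-- The Szegő condition `∫ log σ' dm > -∞`, where `σ'` is the density of the absolutely continuous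
part of `σ` with respect to `m`; the singular part of `σ` is arbitrary.
Here `ENNReal.log` takes the value `-∞` at `0`. For a finite measure `σ` the positive part of
`log σ'` is at most `σ'`, hence always has a finite integral, so the condition says precisely that
the negative part `max (-log σ') 0` has a finite integral. -/
def IsSzego (σ : Measure Circle) : Prop :=
  ∫⁻ z, (-ENNReal.log (σ.rnDeriv circleLebesgue z)).toENNReal ∂circleLebesgue < ∞

/-- `Φ` is the sequence of monic orthogonal polynomials of `σ` on the unit circle: `Φ n` is monic of
degree `n` and is orthogonal in `L²(σ)` to `1, z, …, z ^ (n - 1)`. These conditions determine `Φ`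
as soon as the support of `σ` is infinite, in particular for every Szegő measure. -/
structure IsMonicOPUC (σ : Measure Circle) (Φ : ℕ → ℂ[X]) : Prop where
  monic : ∀ n, (Φ n).Monic
  natDegree_eq : ∀ n, (Φ n).natDegree = n
  orthogonal : ∀ n, ∀ k < n, ∫ z : Circle, conj ((z : ℂ) ^ k) * (Φ n).eval (z : ℂ) ∂σ = 0

end OPUC

namespace OPUC

/-! The measure is built from its Verblunsky coefficients, taken real so that `Φ n` has the explicit
value `∏ (1 - α i)` at `1`. Since `∑ 1 / (A + i)` diverges while `∑ 1 / (A + i) ^ 2` is of order `1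
/ A`, a block of coefficients of size `1 / (A + i)` can raise `|Φ n (1)|` to any height `Y` at an
`ℓ²` cost of at most `4 / A`. A mirrored block of opposite sign then makes the values at `1` decay
fast enough that `∑ |Φ n (1)| ^ 2` stays of order `A * Y ^ 2`, however long the block is
(`sum_prod_bump_sq_le`).

That sum controls the Christoffel–Darboux kernel at `1`: a polynomial `p` of admissible degree
satisfies `|p(1)| ^ 2 ≤ C * A * Y ^ 2 * ∫ |p| ^ 2 dσ` (`norm_sq_eval_one_le`). With `p`
approximating `z ^ m * √(F (|Φ| ^ 2))`, `Φ` being the polynomial at the peak, this bounds `∫ F (|Φ|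
^ 2) dσ` below by about `F (Y ^ 2) / (A * Y ^ 2)`, which superlinearity of `F` makes arbitrarily
large (`exists_bump`). Concatenating such blocks with summable costs gives one square-summable
sequence (`exists_verblunsky`).

A weak limit of Bernstein–Szegő measures has these coefficients (`exists_measure_of_verblunsky`). It
inherits an entropy inequality against continuous test functions, which implies the Szegő condition
(`isSzego_of_entropy`). -/

/-- The monic polynomials `Φ n` with real Verblunsky coefficients `α`, paired with their reversals,
as produced by the Szegő recursion. -/
noncomputable def szegoPair (α : ℕ → ℝ) : ℕ → ℂ[X] × ℂ[X]
  | 0 => (1, 1)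
  | n + 1 =>
    (Polynomial.X * (szegoPair α n).1 - Polynomial.C (α n : ℂ) * (szegoPair α n).2,
      (szegoPair α n).2 - Polynomial.C (α n : ℂ) * (Polynomial.X * (szegoPair α n).1))

/-- The monic polynomial of degree `n` with real Verblunsky coefficients `α`. -/
noncomputable def szegoPoly (α : ℕ → ℝ) (n : ℕ) : ℂ[X] := (szegoPair α n).1

/-- The reversal of `szegoPoly α n`. -/
noncomputable def szegoRev (α : ℕ → ℝ) (n : ℕ) : ℂ[X] := (szegoPair α n).2

/-! ### The Szegő recursion with real coefficients. -/

section Recursion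

variable (α : ℕ → ℝ)

@[simp] lemma szegoPoly_zero : szegoPoly α 0 = 1 := rfl

@[simp] lemma szegoRev_zero : szegoRev α 0 = 1 := rfl

lemma szegoPoly_succ (n : ℕ) : szegoPoly α (n + 1) =
    Polynomial.X * szegoPoly α n - Polynomial.C (α n : ℂ) * szegoRev α n := rfl

lemma szegoRev_succ (n : ℕ) : szegoRev α (n + 1) =
    szegoRev α n - Polynomial.C (α n : ℂ) * (Polynomial.X * szegoPoly α n) := rfl

lemma eval_szegoPoly_succ (n : ℕ) (z : ℂ) : (szegoPoly α (n + 1)).eval z =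
    z * (szegoPoly α n).eval z - α n * (szegoRev α n).eval z := by
  simp [szegoPoly_succ]

lemma eval_szegoRev_succ (n : ℕ) (z : ℂ) : (szegoRev α (n + 1)).eval z =
    (szegoRev α n).eval z - α n * (z * (szegoPoly α n).eval z) := by
  simp [szegoRev_succ]

lemma szegoPair_congr {α β : ℕ → ℝ} {n : ℕ} (h : ∀ i < n, α i = β i) :
    szegoPair α n = szegoPair β n := by
  induction n with
  | zero => rfl
  | succ n ih =>
    rw [szegoPair, szegoPair, ih fun i hi => h i (by omega), h n (by omega)]

lemma szegoPoly_congr {α β : ℕ → ℝ} {n : ℕ} (h : ∀ i < n, α i = β i) :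
    szegoPoly α n = szegoPoly β n := by
  rw [szegoPoly, szegoPoly, szegoPair_congr h]

lemma szegoPoly_degree_aux (n : ℕ) : (szegoPoly α n).Monic ∧ (szegoPoly α n).natDegree = n ∧
    (szegoRev α n).natDegree ≤ n := by
  induction n with
  | zero => simp [Polynomial.monic_one]
  | succ n ih =>
    obtain ⟨hm, hd, hr⟩ := ih
    have hXm : (Polynomial.X * szegoPoly α n).Monic := Polynomial.monic_X.mul hm
    have hXd : (Polynomial.X * szegoPoly α n).natDegree = n + 1 := by
      rw [Polynomial.natDegree_X_mul hm.ne_zero, hd]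
    have hCd : (Polynomial.C (α n : ℂ) * szegoRev α n).natDegree ≤ n :=
      (Polynomial.natDegree_C_mul_le _ _).trans hr
    have hlt : (Polynomial.C (α n : ℂ) * szegoRev α n).degree <
        (Polynomial.X * szegoPoly α n).degree := by
      apply Polynomial.degree_lt_degree; omega
    refine ⟨hXm.sub_of_left hlt, ?_, ?_⟩
    · rw [szegoPoly_succ, Polynomial.natDegree_sub_eq_left_of_natDegree_lt (by omega), hXd]
    · rw [szegoRev_succ]
      refine (Polynomial.natDegree_sub_le _ _).trans (max_le (by omega) ?_)
      exact (Polynomial.natDegree_C_mul_le _ _).trans hXd.le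

lemma monic_szegoPoly (n : ℕ) : (szegoPoly α n).Monic := (szegoPoly_degree_aux α n).1

lemma natDegree_szegoPoly (n : ℕ) : (szegoPoly α n).natDegree = n := (szegoPoly_degree_aux α n).2.1

lemma natDegree_szegoRev_le (n : ℕ) : (szegoRev α n).natDegree ≤ n := (szegoPoly_degree_aux α n).2.2

lemma eval_zero_szegoRev (n : ℕ) : (szegoRev α n).eval 0 = 1 := by
  induction n with
  | zero => simp
  | succ n ih => simp [eval_szegoRev_succ, ih]

/-- On the circle `conj z = z⁻¹`. Each identity needs the other in the induction step. -/
lemma eval_szegoRev_circle (n : ℕ) (z : Circle) :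
    (szegoRev α n).eval (z : ℂ) = (z : ℂ) ^ n * conj ((szegoPoly α n).eval (z : ℂ)) ∧
      (szegoPoly α n).eval (z : ℂ) = (z : ℂ) ^ n * conj ((szegoRev α n).eval (z : ℂ)) := by
  have hz : (z : ℂ) * conj (z : ℂ) = 1 := by
    rw [Complex.mul_conj, Circle.normSq_coe]; simp
  induction n with
  | zero => simp
  | succ n ih =>
    obtain ⟨h1, h2⟩ := ih
    rw [eval_szegoPoly_succ, eval_szegoRev_succ]
    simp only [map_sub, map_mul, Complex.conj_ofReal]
    constructor
    · linear_combination h1 - α n * z * h2 -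
        (z : ℂ) ^ n * conj ((szegoPoly α n).eval (z : ℂ)) * hz
    · linear_combination z * h2 - α n * h1 +
        α n * (z : ℂ) ^ n * conj ((szegoPoly α n).eval (z : ℂ)) * hz

lemma norm_eval_szegoRev_circle (n : ℕ) (z : Circle) :
    ‖(szegoRev α n).eval (z : ℂ)‖ = ‖(szegoPoly α n).eval (z : ℂ)‖ := by
  rw [(eval_szegoRev_circle α n z).1, norm_mul, norm_pow, Circle.norm_coe, one_pow, one_mul,
    RCLike.norm_conj]

/-- At `z = 1` with real coefficients both components of the recursion are multiplied by the same
factor `1 - α n`. -/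
lemma eval_one_szegoPoly (n : ℕ) :
    (szegoPoly α n).eval 1 = ((∏ i ∈ Finset.range n, (1 - α i) : ℝ) : ℂ) := by
  suffices (szegoPoly α n).eval 1 = ((∏ i ∈ Finset.range n, (1 - α i) : ℝ) : ℂ) ∧
    (szegoRev α n).eval 1 = ((∏ i ∈ Finset.range n, (1 - α i) : ℝ) : ℂ) from this.1
  induction n with
  | zero => simp
  | succ n ih =>
    rw [eval_szegoPoly_succ, eval_szegoRev_succ, ih.1, ih.2, Finset.prod_range_succ]
    push_cast
    constructor <;> ring

variable {α}

/-- For real `a`, `|q - a p| ^ 2 - |p - a q| ^ 2 = (1 - a ^ 2) (|q| ^ 2 - |p| ^ 2)`, applied with `p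
= z Φ n (z)` and `q` the value of the reversal. The zero-freeness makes the reciprocal of the
reversal holomorphic on the closed disc. -/
lemma eval_szegoRev_disc (hα : ∀ i, |α i| < 1) (n : ℕ) {z : ℂ} (hz : ‖z‖ ≤ 1) :
    ‖(szegoPoly α n).eval z‖ ≤ ‖(szegoRev α n).eval z‖ ∧ (szegoRev α n).eval z ≠ 0 := by
  induction n with
  | zero => simp
  | succ n ih =>
    obtain ⟨h1, h2⟩ := ih
    rw [eval_szegoPoly_succ, eval_szegoRev_succ]
    set q := (szegoRev α n).eval z
    have hle : ‖z * (szegoPoly α n).eval z‖ ≤ ‖q‖ := by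
      rw [norm_mul]
      exact (mul_le_of_le_one_left (norm_nonneg _) hz).trans h1
    set p := z * (szegoPoly α n).eval z
    have hq : 0 < ‖q‖ := norm_pos_iff.mpr h2
    have ha := hα n
    constructor
    · refine (sq_le_sq₀ (norm_nonneg _) (norm_nonneg _)).1 ?_
      have hsq : ‖p‖ ^ 2 ≤ ‖q‖ ^ 2 := by gcongr
      have ha2 : (α n) ^ 2 ≤ 1 := by rw [sq_le_one_iff_abs_le_one]; exact ha.le
      simp only [← Complex.normSq_eq_norm_sq, Complex.normSq_apply, Complex.sub_re, Complex.sub_im,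
        Complex.mul_re, Complex.mul_im, Complex.ofReal_re, Complex.ofReal_im] at hsq ⊢
      nlinarith [mul_nonneg (sub_nonneg.mpr ha2) (sub_nonneg.mpr hsq)]
    · intro h0
      rw [sub_eq_zero] at h0
      have : ‖q‖ = |α n| * ‖p‖ := by rw [h0, norm_mul, Complex.norm_real, Real.norm_eq_abs]
      nlinarith [mul_le_mul_of_nonneg_left hle (abs_nonneg (α n))]

lemma eval_szegoPoly_circle_ne_zero (hα : ∀ i, |α i| < 1) (n : ℕ) (z : Circle) :
    (szegoPoly α n).eval (z : ℂ) ≠ 0 := by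
  rw [← norm_ne_zero_iff, ← norm_eval_szegoRev_circle, norm_ne_zero_iff]
  exact (eval_szegoRev_disc hα n (Circle.norm_coe z).le).2

end Recursion

/-! ### Orthogonality, norms and the Christoffel–Darboux kernel at `1`. -/

section Orthogonality

variable {σ : Measure Circle} [IsFiniteMeasure σ]

lemma integrable_of_continuous {E : Type*} [NormedAddCommGroup E] {f : Circle → E}
    (hf : Continuous f) : Integrable f σ :=
  hf.integrable_of_hasCompactSupport (HasCompactSupport.of_compactSpace f)

@[fun_prop]
lemma continuous_eval_circle (p : ℂ[X]) : Continuous fun z : Circle => p.eval (z : ℂ) :=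
  p.continuous.comp continuous_subtype_val

/-- `p` is orthogonal in `L²(σ)` to `1, z, …, z ^ (n - 1)`. -/
def OrthogonalBelow (σ : Measure Circle) (p : ℂ[X]) (n : ℕ) : Prop :=
  ∀ k < n, ∫ z : Circle, conj ((z : ℂ) ^ k) * p.eval (z : ℂ) ∂σ = 0

lemma OrthogonalBelow.integral_conj_mul {p : ℂ[X]} {n : ℕ} (h : OrthogonalBelow σ p n)
    {q : ℂ[X]} (hq : q.natDegree < n) :
    ∫ z : Circle, conj (q.eval (z : ℂ)) * p.eval (z : ℂ) ∂σ = 0 := by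
  have h1 : ∀ z : Circle, conj (q.eval (z : ℂ)) * p.eval (z : ℂ) =
      ∑ k ∈ Finset.range n, conj (q.coeff k) * (conj ((z : ℂ) ^ k) * p.eval (z : ℂ)) := by
    intro z
    rw [Polynomial.eval_eq_sum_range' hq, map_sum, Finset.sum_mul]
    simp only [map_mul, mul_assoc]
  simp_rw [h1]
  rw [integral_finsetSum _ fun k _ => integrable_of_continuous (by fun_prop)]
  refine Finset.sum_eq_zero fun k hk => ?_
  rw [integral_const_mul, h k (Finset.mem_range.mp hk), mul_zero]

lemma integral_norm_sq_add {p q : Circle → ℂ} (hp : Continuous p) (hq : Continuous q)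
    (h : ∫ z, conj (q z) * p z ∂σ = 0) :
    ∫ z, ‖p z + q z‖ ^ 2 ∂σ = ∫ z, ‖p z‖ ^ 2 ∂σ + ∫ z, ‖q z‖ ^ 2 ∂σ := by
  have h1 : ∀ z, ‖p z + q z‖ ^ 2 = ‖p z‖ ^ 2 + ‖q z‖ ^ 2 + 2 * RCLike.re (conj (q z) * p z) := by
    intro z
    simp only [← Complex.normSq_eq_norm_sq, Complex.normSq_apply, Complex.add_re, Complex.add_im,
      RCLike.re_to_complex, Complex.mul_re, Complex.conj_re, Complex.conj_im]
    ring
  have h2 : ∫ z, RCLike.re (conj (q z) * p z) ∂σ = 0 := by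
    rw [integral_re (integrable_of_continuous (by fun_prop)), h, map_zero]
  simp_rw [h1]
  rw [integral_add (integrable_of_continuous (by fun_prop)) (integrable_of_continuous (by fun_prop)),
    integral_add (integrable_of_continuous (by fun_prop)) (integrable_of_continuous (by fun_prop)),
    integral_const_mul, h2]
  ring

variable {α : ℕ → ℝ}

/-- The recursion inverts to `(1 - a ^ 2) z Φ n = Φ (n + 1) + a Φ* (n + 1)`. On the circle, pairing
`Φ*` with `z ^ (k + 1)` is conjugate to pairing `Φ (n + 1)` with `z ^ (n - k)`. Orthogonality thus
descends from a single top index. -/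
lemma OrthogonalBelow.szegoPoly_pred (hα : ∀ i, |α i| < 1) {n : ℕ}
    (h : OrthogonalBelow σ (szegoPoly α (n + 1)) (n + 1)) :
    OrthogonalBelow σ (szegoPoly α n) n := by
  intro k hk
  have h1 : ∀ z : Circle, ((1 - α n ^ 2 : ℝ) : ℂ) *
      (conj ((z : ℂ) ^ k) * (szegoPoly α n).eval (z : ℂ)) =
      conj ((z : ℂ) ^ (k + 1)) * (szegoPoly α (n + 1)).eval (z : ℂ) +
      α n * conj (conj ((z : ℂ) ^ (n - k)) * (szegoPoly α (n + 1)).eval (z : ℂ)) := by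
    intro z
    have hz : (z : ℂ) * conj (z : ℂ) = 1 := by
      rw [Complex.mul_conj, Circle.normSq_coe]; simp
    have hr : conj ((z : ℂ) ^ (k + 1)) * (szegoRev α (n + 1)).eval (z : ℂ) =
        conj (conj ((z : ℂ) ^ (n - k)) * (szegoPoly α (n + 1)).eval (z : ℂ)) := by
      rw [(eval_szegoRev_circle α (n + 1) z).1, map_mul, Complex.conj_conj, map_pow,
        show n + 1 = (n - k) + (k + 1) by omega, pow_add]
      have : (z : ℂ) ^ (k + 1) * (conj (z : ℂ)) ^ (k + 1) = 1 := by
        rw [← mul_pow, hz, one_pow]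
      linear_combination (z : ℂ) ^ (n - k) *
        conj ((szegoPoly α (n - k + (k + 1))).eval (z : ℂ)) * this
    rw [← hr, eval_szegoPoly_succ, eval_szegoRev_succ]
    push_cast
    rw [map_pow, map_pow, pow_succ]
    linear_combination (-(1 - (α n : ℂ) ^ 2) * (conj (z : ℂ)) ^ k * (szegoPoly α n).eval (z : ℂ)) * hz
  have h2 : ((1 - α n ^ 2 : ℝ) : ℂ) * ∫ z : Circle, conj ((z : ℂ) ^ k) *
      (szegoPoly α n).eval (z : ℂ) ∂σ = 0 := by
    rw [← integral_const_mul]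
    simp_rw [h1]
    rw [integral_add (integrable_of_continuous (by fun_prop))
      (integrable_of_continuous (by fun_prop)), integral_const_mul, integral_conj,
      h _ (by omega), h _ (by omega)]
    simp
  refine (mul_eq_zero.mp h2).resolve_left ?_
  have := (sq_lt_one_iff_abs_lt_one (α n)).mpr (hα n)
  exact Complex.ofReal_ne_zero.mpr (by linarith)

lemma OrthogonalBelow.szegoPoly_of_le (hα : ∀ i, |α i| < 1) {n N : ℕ} (hn : n ≤ N)
    (h : OrthogonalBelow σ (szegoPoly α N) N) : OrthogonalBelow σ (szegoPoly α n) n := by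
  induction N, hn using Nat.le_induction with
  | base => exact h
  | succ N _ ih => exact ih (h.szegoPoly_pred hα)

/-- Pythagoras in `z Φ N = Φ (N + 1) + α N Φ* N`: the last term has degree at most `N`, and `|Φ* N|
= |Φ N|` on the circle. -/
lemma integral_norm_sq_szegoPoly {N : ℕ}
    (h : ∀ n ≤ N, OrthogonalBelow σ (szegoPoly α n) n) :
    ∫ z : Circle, ‖(szegoPoly α N).eval (z : ℂ)‖ ^ 2 ∂σ =
      (∏ i ∈ Finset.range N, (1 - α i ^ 2)) * σ.real Set.univ := by
  induction N with
  | zero => simp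
  | succ N ih =>
    have key : ∀ z : Circle, ‖(szegoPoly α N).eval (z : ℂ)‖ ^ 2 =
        ‖(szegoPoly α (N + 1)).eval (z : ℂ) +
          (Polynomial.C (α N : ℂ) * szegoRev α N).eval (z : ℂ)‖ ^ 2 := by
      intro z
      rw [eval_szegoPoly_succ, Polynomial.eval_mul, Polynomial.eval_C, sub_add_cancel, norm_mul,
        Circle.norm_coe, one_mul]
    have hdeg : (Polynomial.C (α N : ℂ) * szegoRev α N).natDegree < N + 1 :=
      Nat.lt_succ_of_le
        ((Polynomial.natDegree_C_mul_le _ _).trans (natDegree_szegoRev_le α N))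
    have h1 := integral_norm_sq_add (σ := σ) (continuous_eval_circle (szegoPoly α (N + 1)))
      (continuous_eval_circle (Polynomial.C (α N : ℂ) * szegoRev α N))
      ((h (N + 1) le_rfl).integral_conj_mul hdeg)
    have h2 : ∀ z : Circle, ‖(Polynomial.C (α N : ℂ) * szegoRev α N).eval (z : ℂ)‖ ^ 2 =
        α N ^ 2 * ‖(szegoPoly α N).eval (z : ℂ)‖ ^ 2 := by
      intro z
      rw [Polynomial.eval_mul, Polynomial.eval_C, norm_mul, norm_eval_szegoRev_circle, mul_pow,
        Complex.norm_real, Real.norm_eq_abs, sq_abs]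
    simp_rw [← key, h2] at h1
    rw [integral_const_mul] at h1
    rw [Finset.prod_range_succ]
    have h3 := ih fun n hn => h n (by omega)
    linear_combination -h1 + (1 - α N ^ 2) * h3

/-- A polynomial of degree at most `N` is dominated at `1` by its norm in `L²(σ)` times the
Christoffel–Darboux kernel at `1`. -/
lemma norm_sq_eval_one_le (hσ : σ.real Set.univ = 1) (hα : ∀ i, |α i| < 1) {N : ℕ}
    (h : ∀ n ≤ N, OrthogonalBelow σ (szegoPoly α n) n) {p : ℂ[X]} (hp : p.natDegree ≤ N) :
    ‖p.eval 1‖ ^ 2 ≤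
      (∑ n ∈ Finset.range (N + 1), ‖(szegoPoly α n).eval 1‖ ^ 2 /
        ∏ i ∈ Finset.range n, (1 - α i ^ 2)) * ∫ z : Circle, ‖p.eval (z : ℂ)‖ ^ 2 ∂σ := by
  have hprod : ∀ n, 0 < ∏ i ∈ Finset.range n, (1 - α i ^ 2) := fun n =>
    Finset.prod_pos fun i _ => by
      have := (sq_lt_one_iff_abs_lt_one (α i)).mpr (hα i); linarith
  induction N generalizing p with
  | zero =>
    rw [Polynomial.eq_C_of_natDegree_le_zero hp]
    simp [hσ]
  | succ N ih =>
    set c := p.coeff (N + 1)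
    set q := p - Polynomial.C c * szegoPoly α (N + 1) with hq
    have hqN : q.natDegree ≤ N := by
      have hle : q.natDegree ≤ N + 1 := by
        refine (Polynomial.natDegree_sub_le _ _).trans (max_le hp ?_)
        exact (Polynomial.natDegree_C_mul_le _ _).trans (natDegree_szegoPoly α _).le
      by_contra! hlt
      have heq : q.natDegree = N + 1 := by omega
      have hc : q.coeff (N + 1) = 0 := by
        have := monic_szegoPoly α (N + 1)
        rw [Polynomial.Monic, Polynomial.leadingCoeff, natDegree_szegoPoly] at this
        rw [hq, Polynomial.coeff_sub, Polynomial.coeff_C_mul, this, mul_one, sub_self]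
      rw [← heq, Polynomial.coeff_natDegree, Polynomial.leadingCoeff_eq_zero] at hc
      rw [hc, Polynomial.natDegree_zero] at heq
      omega
    have hih := ih (fun n hn => h n (by omega)) hqN
    have hpe : ∀ z : ℂ, p.eval z = c * (szegoPoly α (N + 1)).eval z + q.eval z := by
      intro z; simp [hq]
    have horth : ∫ z : Circle, conj (q.eval (z : ℂ)) *
        (c * (szegoPoly α (N + 1)).eval (z : ℂ)) ∂σ = 0 := by
      have := (h (N + 1) le_rfl).integral_conj_mul (q := q) (by omega)
      simp_rw [mul_left_comm _ c]
      rw [integral_const_mul, this, mul_zero]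
    have hpyth := integral_norm_sq_add (σ := σ) (by fun_prop) (by fun_prop) horth
    simp_rw [← hpe, norm_mul, mul_pow] at hpyth
    rw [integral_const_mul, integral_norm_sq_szegoPoly h, hσ, mul_one] at hpyth
    rw [Finset.sum_range_succ, hpyth]
    set K := ∑ n ∈ Finset.range (N + 1), ‖(szegoPoly α n).eval 1‖ ^ 2 /
        ∏ i ∈ Finset.range n, (1 - α i ^ 2)
    set d := ∏ i ∈ Finset.range (N + 1), (1 - α i ^ 2) with hd
    have hdpos : 0 < d := hprod (N + 1)
    set I := ∫ z : Circle, ‖q.eval (z : ℂ)‖ ^ 2 ∂σ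
    set u := ‖(szegoPoly α (N + 1)).eval 1‖
    have hK : 0 ≤ K := Finset.sum_nonneg fun n _ => div_nonneg (sq_nonneg _) (hprod n).le
    have hI : 0 ≤ I := integral_nonneg fun z => sq_nonneg _
    have htri : ‖p.eval 1‖ ≤ ‖c‖ * u + ‖q.eval 1‖ := by
      rw [hpe 1, ← norm_mul]; exact norm_add_le _ _
    have hsq := pow_le_pow_left₀ (norm_nonneg _) htri 2
    refine hsq.trans ?_
    set v := ‖q.eval 1‖
    -- The cross term of `(‖c‖ u + v) ^ 2` is absorbed by AM-GM into the two mixed terms of `(K + u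
    -- ^ 2 / d) (‖c‖ ^ 2 d + I)`, using `v ^ 2 ≤ K I` from induction.
    have hx : 2 * (‖c‖ * u * v) ≤ u ^ 2 / d * I + K * (‖c‖ ^ 2 * d) := by
      refine (mul_self_le_mul_self_iff ?_ ?_).mpr ?_
      · positivity
      · positivity
      · have h1 : (‖c‖ * u * v) ^ 2 ≤ (u ^ 2 / d * I) * (K * (‖c‖ ^ 2 * d)) := by
          have : (u ^ 2 / d * I) * (K * (‖c‖ ^ 2 * d)) = (‖c‖ * u) ^ 2 * (K * I) := by
            field_simp
          rw [this, mul_pow]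
          gcongr
        nlinarith [sq_nonneg (u ^ 2 / d * I - K * (‖c‖ ^ 2 * d))]
    have h2 : u ^ 2 / d * (‖c‖ ^ 2 * d) = ‖c‖ ^ 2 * u ^ 2 := by field_simp
    nlinarith

end Orthogonality

/-! ### Bernstein–Szegő measures. -/

section BernsteinSzego

instance : IsProbabilityMeasure circleLebesgue := by
  constructor
  have hexp : Measurable (Circle.exp : ℝ → Circle) := Circle.exp.continuous.measurable
  rw [circleLebesgue, Measure.smul_apply, Measure.map_apply hexp MeasurableSet.univ,
    Set.preimage_univ, Measure.restrict_apply_univ, Real.volume_Ioc, smul_eq_mul,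
    ← ENNReal.ofReal_mul (by positivity)]
  rw [show 1 / (2 * Real.pi) * (Real.pi - -Real.pi) = 1 by field_simp; ring, ENNReal.ofReal_one]

lemma integral_circleLebesgue {E : Type*} [NormedAddCommGroup E] [NormedSpace ℝ E]
    {f : ℂ → E} (hf : Continuous fun z : Circle => f z) :
    ∫ z : Circle, f z ∂circleLebesgue = Real.circleAverage f 0 1 := by
  have hexp : Measurable (Circle.exp : ℝ → Circle) := Circle.exp.continuous.measurable
  have hmap : ∀ θ : ℝ, circleMap 0 1 θ = Circle.exp θ := fun θ => by
    rw [circleMap_zero, Circle.coe_exp, Complex.ofReal_one, one_mul]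
  have hper : Function.Periodic (fun θ : ℝ => f (Circle.exp θ)) (2 * Real.pi) := fun θ => by
    simp only [← hmap]
    rw [periodic_circleMap 0 1 θ]
  rw [circleLebesgue, integral_smul_measure, integral_map hexp.aemeasurable
    hf.aestronglyMeasurable_of_compactSpace, ENNReal.toReal_ofReal (by positivity),
    Real.circleAverage_def, one_div,
    ← intervalIntegral.integral_of_le (by linarith [Real.pi_pos])]
  simp_rw [hmap]
  have := hper.intervalIntegral_add_eq (-Real.pi) 0
  rw [zero_add, show -Real.pi + 2 * Real.pi = Real.pi by ring] at this
  rw [this]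

variable {α : ℕ → ℝ}

/-- The Bernstein–Szegő measure with Verblunsky coefficients `α 0, …, α (N - 1), 0, 0, …`. -/
noncomputable def bernsteinSzego (α : ℕ → ℝ) (N : ℕ) : Measure Circle :=
  circleLebesgue.withDensity fun z => ENNReal.ofReal
    ((∏ i ∈ Finset.range N, (1 - α i ^ 2)) / ‖(szegoPoly α N).eval (z : ℂ)‖ ^ 2)

lemma prod_one_sub_sq_pos (hα : ∀ i, |α i| < 1) (N : ℕ) :
    0 < ∏ i ∈ Finset.range N, (1 - α i ^ 2) :=
  Finset.prod_pos fun i _ => by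
    have := (sq_lt_one_iff_abs_lt_one (α i)).mpr (hα i); linarith

lemma continuous_bernsteinSzego_density (hα : ∀ i, |α i| < 1) (N : ℕ) :
    Continuous fun z : Circle =>
      (∏ i ∈ Finset.range N, (1 - α i ^ 2)) / ‖(szegoPoly α N).eval (z : ℂ)‖ ^ 2 :=
  Continuous.div (by fun_prop) (by fun_prop) fun z =>
    pow_ne_zero 2 (norm_ne_zero_iff.mpr (eval_szegoPoly_circle_ne_zero hα N z))

lemma integral_bernsteinSzego (hα : ∀ i, |α i| < 1) (N : ℕ) {E : Type*} [NormedAddCommGroup E]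
    [NormedSpace ℝ E] (g : Circle → E) :
    ∫ z, g z ∂bernsteinSzego α N = ∫ z : Circle, ((∏ i ∈ Finset.range N, (1 - α i ^ 2)) /
      ‖(szegoPoly α N).eval (z : ℂ)‖ ^ 2) • g z ∂circleLebesgue := by
  rw [bernsteinSzego, integral_withDensity_eq_integral_toReal_smul
    (continuous_bernsteinSzego_density hα N).measurable.ennreal_ofReal
    (Eventually.of_forall fun z => ENNReal.ofReal_lt_top)]
  congr 1 with z
  rw [ENNReal.toReal_ofReal (div_nonneg (prod_one_sub_sq_pos hα N).le (sq_nonneg _))]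

instance (N : ℕ) [h : Fact (∀ i, |α i| < 1)] : IsFiniteMeasure (bernsteinSzego α N) :=
  isFiniteMeasure_withDensity_ofReal
    (integrable_of_continuous (continuous_bernsteinSzego_density h.out N)).2

/-- Against the density, `conj (z ^ k) Φ N` becomes `c z ^ (N - k) / Φ* N`, which is holomorphic on
the closed disc and vanishes at `0`; the mean value property concludes. -/
lemma orthogonalBelow_bernsteinSzego_self (hα : ∀ i, |α i| < 1) (N : ℕ) :
    OrthogonalBelow (bernsteinSzego α N) (szegoPoly α N) N := by
  intro k hk
  rw [integral_bernsteinSzego hα]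
  set c := ∏ i ∈ Finset.range N, (1 - α i ^ 2)
  have hne : ∀ z : Circle, (szegoRev α N).eval (z : ℂ) ≠ 0 := fun z =>
    (eval_szegoRev_disc hα N (Circle.norm_coe z).le).2
  have h1 : ∀ z : Circle, (c / ‖(szegoPoly α N).eval (z : ℂ)‖ ^ 2) •
      (conj ((z : ℂ) ^ k) * (szegoPoly α N).eval (z : ℂ)) =
      (fun w : ℂ => c * (w ^ (N - k) * ((szegoRev α N).eval w)⁻¹)) z := by
    intro z
    have hz : (z : ℂ) * conj (z : ℂ) = 1 := by
      rw [Complex.mul_conj, Circle.normSq_coe]; simp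
    have hp := eval_szegoPoly_circle_ne_zero hα N z
    have hzk : (z : ℂ) ^ k * (conj (z : ℂ)) ^ k = 1 := by rw [← mul_pow, hz, one_pow]
    have hnorm : ((‖(szegoPoly α N).eval (z : ℂ)‖ : ℂ)) ^ 2 =
        (szegoPoly α N).eval (z : ℂ) * conj ((szegoPoly α N).eval (z : ℂ)) := by
      rw [Complex.mul_conj, Complex.normSq_eq_norm_sq]; push_cast; rfl
    have hr := (eval_szegoRev_circle α N z).1
    have hzN : (z : ℂ) ^ N = (z : ℂ) ^ (N - k) * (z : ℂ) ^ k := by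
      rw [← pow_add]; congr 1; omega
    have hcp : conj ((szegoPoly α N).eval (z : ℂ)) ≠ 0 := (map_ne_zero _).mpr hp
    have hr0 := hne z
    rw [Complex.real_smul]
    push_cast
    rw [hnorm, map_pow, hr]
    have hz0 : (z : ℂ) ^ N ≠ 0 := pow_ne_zero _ (Circle.coe_ne_zero z)
    field_simp
    rw [hzN]
    linear_combination (c : ℂ) * (z : ℂ) ^ (N - k) * hzk
  simp_rw [h1]
  rw [integral_circleLebesgue (f := fun w : ℂ => c * (w ^ (N - k) * ((szegoRev α N).eval w)⁻¹))]
  · rw [DiffContOnCl.circleAverage]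
    · simp [show N - k ≠ 0 by omega]
    · refine DifferentiableOn.diffContOnCl_ball (U := Metric.closedBall 0 1) (fun w hw => ?_)
        (by simp)
      have hw1 : ‖w‖ ≤ 1 := by simpa using hw
      exact ((differentiableAt_const _).mul ((differentiableAt_pow _).mul
        ((szegoRev α N).differentiable w |>.inv
          (eval_szegoRev_disc hα N hw1).2))).differentiableWithinAt
  · exact continuous_const.mul ((continuous_subtype_val.pow _).mul
      ((continuous_eval_circle _).inv₀ hne))

/-- The integral of `|Φ N| ^ 2` is `c` by cancellation with the density, and `c` times the total
mass by the norm formula. -/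
lemma real_univ_bernsteinSzego (hα : ∀ i, |α i| < 1) (N : ℕ) :
    (bernsteinSzego α N).real Set.univ = 1 := by
  have : Fact (∀ i, |α i| < 1) := ⟨hα⟩
  have h1 := integral_norm_sq_szegoPoly (σ := bernsteinSzego α N) (α := α) (N := N) fun n hn =>
    (orthogonalBelow_bernsteinSzego_self hα N).szegoPoly_of_le hα hn
  rw [integral_bernsteinSzego hα] at h1
  have hpos := prod_one_sub_sq_pos hα N
  have h2 : ∀ z : Circle, ((∏ i ∈ Finset.range N, (1 - α i ^ 2)) /
      ‖(szegoPoly α N).eval (z : ℂ)‖ ^ 2) • ‖(szegoPoly α N).eval (z : ℂ)‖ ^ 2 =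
      ∏ i ∈ Finset.range N, (1 - α i ^ 2) := fun z => by
    rw [smul_eq_mul, div_mul_cancel₀]
    exact pow_ne_zero 2 (norm_ne_zero_iff.mpr (eval_szegoPoly_circle_ne_zero hα N z))
  simp_rw [h2] at h1
  rw [integral_const, probReal_univ, one_smul] at h1
  exact (mul_left_cancel₀ hpos.ne' (h1.symm.trans (mul_one _).symm))

lemma isProbabilityMeasure_bernsteinSzego (hα : ∀ i, |α i| < 1) (N : ℕ) :
    IsProbabilityMeasure (bernsteinSzego α N) := by
  have h := real_univ_bernsteinSzego hα N
  exact ⟨by rwa [measureReal_def, ENNReal.toReal_eq_one_iff] at h⟩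

/-- `log |Φ* N|` is harmonic near the closed disc and vanishes at `0`. -/
lemma integral_log_norm_szegoPoly (hα : ∀ i, |α i| < 1) (N : ℕ) :
    ∫ z : Circle, Real.log ‖(szegoPoly α N).eval (z : ℂ)‖ ∂circleLebesgue = 0 := by
  simp_rw [← norm_eval_szegoRev_circle]
  rw [integral_circleLebesgue (f := fun w : ℂ => Real.log ‖(szegoRev α N).eval w‖),
    AnalyticOnNhd.circleAverage_log_norm_of_ne_zero (g := fun w => (szegoRev α N).eval w)]
  · simp [eval_zero_szegoRev]
  · exact fun w _ => (szegoRev α N).differentiable.analyticAt w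
  · intro w hw
    exact (eval_szegoRev_disc hα N (by simpa using hw)).2
  · exact Continuous.log (by fun_prop) fun z =>
      norm_ne_zero_iff.mpr (eval_szegoRev_disc hα N (Circle.norm_coe z).le).2

/-- Integrate `1 + x ≤ exp x` at `x = h + log c - 2 log |Φ N|`; the last term has mean zero. Only
continuous integrands appear, so the bound survives weak limits. -/
lemma entropy_bernsteinSzego (hα : ∀ i, |α i| < 1) (N : ℕ) {h : Circle → ℝ}
    (hh : Continuous h) :
    1 + ∫ z, h z ∂circleLebesgue + Real.log (∏ i ∈ Finset.range N, (1 - α i ^ 2)) ≤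
      ∫ z, Real.exp (h z) ∂bernsteinSzego α N := by
  rw [integral_bernsteinSzego hα]
  set c := ∏ i ∈ Finset.range N, (1 - α i ^ 2)
  have hc : 0 < c := prod_one_sub_sq_pos hα N
  have hne : ∀ z : Circle, ‖(szegoPoly α N).eval (z : ℂ)‖ ≠ 0 := fun z =>
    norm_ne_zero_iff.mpr (eval_szegoPoly_circle_ne_zero hα N z)
  have hlog : Continuous fun z : Circle => Real.log ‖(szegoPoly α N).eval (z : ℂ)‖ :=
    Continuous.log (by fun_prop) hne
  have hint : ∫ z : Circle, (1 + h z + Real.log c -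
      2 * Real.log ‖(szegoPoly α N).eval (z : ℂ)‖) ∂circleLebesgue =
      1 + ∫ z, h z ∂circleLebesgue + Real.log c := by
    rw [integral_sub (integrable_of_continuous (by fun_prop))
      (integrable_of_continuous (by fun_prop)), integral_const_mul,
      integral_log_norm_szegoPoly hα, integral_add (integrable_of_continuous (by fun_prop))
      (integrable_of_continuous (by fun_prop)), integral_add (integrable_of_continuous
      (by fun_prop)) (integrable_of_continuous (by fun_prop))]
    simp
  rw [← hint]
  refine integral_mono (integrable_of_continuous (by fun_prop)) (integrable_of_continuous
    ((continuous_bernsteinSzego_density hα N).smul (by fun_prop))) fun z => ?_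
  have hpos : 0 < ‖(szegoPoly α N).eval (z : ℂ)‖ := lt_of_le_of_ne (norm_nonneg _) (hne z).symm
  have h1 : c / ‖(szegoPoly α N).eval (z : ℂ)‖ ^ 2 * Real.exp (h z) =
      Real.exp (h z + Real.log c - 2 * Real.log ‖(szegoPoly α N).eval (z : ℂ)‖) := by
    rw [Real.exp_sub, Real.exp_add, Real.exp_log hc, two_mul, Real.exp_add, Real.exp_log hpos]
    field_simp
  simp only [smul_eq_mul]
  rw [h1]
  linarith [Real.add_one_le_exp
    (h z + Real.log c - 2 * Real.log ‖(szegoPoly α N).eval (z : ℂ)‖)]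

end BernsteinSzego

/-! ### Weak limits: a measure with prescribed coefficients. -/

section Limit

lemma continuous_integral_complex {f : Circle → ℂ} (hf : Continuous f) :
    Continuous fun μ : ProbabilityMeasure Circle => ∫ z, f z ∂(μ : Measure Circle) := by
  rw [continuous_iff_continuousAt]
  intro μ
  exact (ProbabilityMeasure.tendsto_iff_forall_integral_rclike_tendsto ℂ).mp tendsto_id
    (BoundedContinuousFunction.mkOfCompact ⟨f, hf⟩)

/-- Real Verblunsky coefficients with `∏ (1 - α i ^ 2)` bounded below belong to a probability
measure satisfying an entropy inequality. -/
theorem exists_measure_of_verblunsky {α : ℕ → ℝ} (hα : ∀ i, |α i| < 1) {c : ℝ} (hc : 0 < c)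
    (hprod : ∀ N, c ≤ ∏ i ∈ Finset.range N, (1 - α i ^ 2)) :
    ∃ σ : Measure Circle, IsProbabilityMeasure σ ∧
      (∀ n, OrthogonalBelow σ (szegoPoly α n) n) ∧
      ∀ h : Circle → ℝ, Continuous h →
        1 + ∫ z, h z ∂circleLebesgue + Real.log c ≤ ∫ z, Real.exp (h z) ∂σ := by
  -- Nested weakly closed sets in a compact space, the `N`-th containing `bernsteinSzego α N`; any
  -- common point is the desired measure.
  let K : ℕ → Set (ProbabilityMeasure Circle) := fun N =>
    {μ | (∀ n ≤ N, OrthogonalBelow (μ : Measure Circle) (szegoPoly α n) n) ∧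
      ∀ h : Circle → ℝ, Continuous h →
        1 + ∫ z, h z ∂circleLebesgue + Real.log c ≤ ∫ z, Real.exp (h z) ∂(μ : Measure Circle)}
  have hclosed : ∀ N, IsClosed (K N) := by
    intro N
    have hK : K N = (⋂ (n : ℕ) (_ : n ≤ N) (k : ℕ) (_ : k < n),
          {μ : ProbabilityMeasure Circle | ∫ z : Circle, conj ((z : ℂ) ^ k) *
            (szegoPoly α n).eval (z : ℂ) ∂(μ : Measure Circle) = 0}) ∩
        ⋂ (h : Circle → ℝ) (_ : Continuous h), {μ : ProbabilityMeasure Circle |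
          1 + ∫ z, h z ∂circleLebesgue + Real.log c ≤
            ∫ z, Real.exp (h z) ∂(μ : Measure Circle)} := by
      ext μ
      simp only [K, OrthogonalBelow, Set.mem_inter_iff, Set.mem_iInter, Set.mem_ofPred_eq]
    rw [hK]
    refine IsClosed.inter (isClosed_iInter fun n => isClosed_iInter fun _ => isClosed_iInter fun k =>
      isClosed_iInter fun _ => ?_) (isClosed_iInter fun h => isClosed_iInter fun hh => ?_)
    · exact isClosed_eq (continuous_integral_complex (by fun_prop)) continuous_const
    · exact isClosed_le continuous_const (ProbabilityMeasure.continuous_integral_continuousMap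
        (⟨fun z => Real.exp (h z), by fun_prop⟩ : C(Circle, ℝ)))
  obtain ⟨μ, hμ⟩ := IsCompact.nonempty_iInter_of_sequence_nonempty_isCompact_isClosed K
    (fun N μ hμ => ⟨fun n hn => hμ.1 n (by omega), hμ.2⟩)
    (fun N => ⟨⟨bernsteinSzego α N, isProbabilityMeasure_bernsteinSzego hα N⟩, fun n hn => by
        have : Fact (∀ i, |α i| < 1) := ⟨hα⟩
        exact OrthogonalBelow.szegoPoly_of_le (σ := bernsteinSzego α N) hα hn
          (orthogonalBelow_bernsteinSzego_self hα N),
      fun h hh => (add_le_add_right (Real.log_le_log hc (hprod N)) _).trans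
        (entropy_bernsteinSzego hα N hh)⟩)
    (hclosed 0).isCompact hclosed
  rw [Set.mem_iInter] at hμ
  exact ⟨μ, inferInstance, fun n => (hμ n).1 n le_rfl, (hμ 0).2⟩

end Limit

/-! ### From the entropy inequality to the Szegő condition. -/

section Entropy

variable {σ : Measure Circle} [IsProbabilityMeasure σ] {C : ℝ}

lemma entropy_of_measurable
    (hent : ∀ h : Circle → ℝ, Continuous h →
      ∫ z, h z ∂circleLebesgue ≤ C + ∫ z, Real.exp (h z) ∂σ)
    {h : Circle → ℝ} (hh : Measurable h) {R : ℝ} (h0 : ∀ z, 0 ≤ h z) (hR : ∀ z, h z ≤ R) :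
    ∫ z, h z ∂circleLebesgue ≤ C + ∫ z, Real.exp (h z) ∂σ := by
  have hR0 : 0 ≤ R := (h0 1).trans (hR 1)
  have hint : ∀ (ν : Measure Circle) [IsFiniteMeasure ν], Integrable h ν := fun ν _ =>
    Integrable.of_bound hh.aestronglyMeasurable R (Eventually.of_forall fun z => by
      rw [Real.norm_eq_abs, abs_of_nonneg (h0 z)]; exact hR z)
  have hexpint : Integrable (fun z => Real.exp (h z)) σ :=
    Integrable.of_bound (by fun_prop) (Real.exp R) (Eventually.of_forall fun z => by
      rw [Real.norm_eq_abs, abs_of_pos (Real.exp_pos _)]; exact Real.exp_le_exp.mpr (hR z))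
  refine le_of_forall_pos_le_add fun δ hδ => ?_
  -- Approximation in `L¹(m + σ)` handles both sides at once. After truncation to `[0, R]`, passing
  -- from `h` to `g` costs at most the `L¹(m)` error on the left and `exp R` times the `L¹(σ)` error
  -- on the right.
  obtain ⟨g, hg, -⟩ := (hint (circleLebesgue + σ)).exists_boundedContinuous_integral_sub_le
    (ε := δ / (1 + Real.exp R)) (by positivity)
  set g' : Circle → ℝ := fun z => max 0 (min R (g z)) with hg'
  have hgc : Continuous g' := by fun_prop
  have hg0 : ∀ z, 0 ≤ g' z := fun z => le_max_left _ _
  have hgR : ∀ z, g' z ≤ R := fun z => max_le hR0 (min_le_left _ _)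
  have hdiff : ∀ z, |h z - g' z| ≤ ‖h z - g z‖ := by
    intro z
    have h1 : h z = max 0 (min R (h z)) := by
      rw [min_eq_right (hR z), max_eq_right (h0 z)]
    rw [Real.norm_eq_abs]
    calc |h z - g' z| = |max 0 (min R (h z)) - max 0 (min R (g z))| := by rw [← h1]
      _ ≤ |min R (h z) - min R (g z)| := by
          simpa using abs_max_sub_max_le_max 0 (min R (h z)) 0 (min R (g z))
      _ ≤ |h z - g z| := by
          simpa using abs_min_sub_min_le_max R (h z) R (g z)
  have hgint : ∀ (ν : Measure Circle) [IsFiniteMeasure ν],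
      Integrable (fun z => |h z - g' z|) ν := fun ν _ =>
    ((hint ν).sub (integrable_of_continuous hgc)).abs
  have hnint : ∀ (ν : Measure Circle) [IsFiniteMeasure ν],
      Integrable (fun z => ‖h z - g z‖) ν := fun ν _ =>
    ((hint ν).sub (integrable_of_continuous g.continuous)).norm
  have hsum : ∫ z, |h z - g' z| ∂circleLebesgue + ∫ z, |h z - g' z| ∂σ ≤
      δ / (1 + Real.exp R) := by
    rw [← integral_add_measure (hgint _) (hgint _)]
    exact (integral_mono (hgint _) (hnint _) hdiff).trans hg
  have e1 : ∫ z, h z ∂circleLebesgue ≤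
      ∫ z, g' z ∂circleLebesgue + ∫ z, |h z - g' z| ∂circleLebesgue := by
    rw [← integral_add (integrable_of_continuous hgc) (hgint _)]
    exact integral_mono (hint _) ((integrable_of_continuous hgc).add (hgint _)) fun z => by
      have := le_abs_self (h z - g' z)
      linarith
  have e2 : ∫ z, Real.exp (g' z) ∂σ ≤
      ∫ z, Real.exp (h z) ∂σ + Real.exp R * ∫ z, |h z - g' z| ∂σ := by
    rw [← integral_const_mul, ← integral_add hexpint ((hgint _).const_mul _)]
    refine integral_mono (integrable_of_continuous (by fun_prop))
      (hexpint.add ((hgint _).const_mul _)) fun z => ?_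
    have h1 := Real.add_one_le_exp (h z - g' z)
    have h2 : Real.exp (h z) = Real.exp (g' z) * Real.exp (h z - g' z) := by
      rw [← Real.exp_add]; congr 1; ring
    have h3 := neg_abs_le (h z - g' z)
    have h4 := mul_le_mul_of_nonneg_left h1 (Real.exp_pos (g' z)).le
    have h5 := mul_le_mul_of_nonneg_right (Real.exp_le_exp.mpr (hgR z)) (abs_nonneg (h z - g' z))
    have h6 := mul_le_mul_of_nonneg_left h3 (Real.exp_pos (g' z)).le
    rw [h2]
    linarith
  have e3 := hent g' hgc
  have n1 : 0 ≤ ∫ z, |h z - g' z| ∂circleLebesgue := integral_nonneg fun z => abs_nonneg _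
  have n2 : 0 ≤ ∫ z, |h z - g' z| ∂σ := integral_nonneg fun z => abs_nonneg _
  rw [le_div_iff₀ (by positivity)] at hsum
  nlinarith [mul_nonneg n1 (Real.exp_pos R).le]

/-- For finite positive `w` the exponential is at most `max (1 / w) 1`. At `w = 0` the truncation at
`R` makes the product `0`. -/
lemma ofReal_exp_mul_le (w : ℝ≥0∞) (R : ℕ) :
    w * ENNReal.ofReal (Real.exp (min (-ENNReal.log w).toENNReal R).toReal) ≤ 1 + w := by
  rcases ENNReal.trichotomy w with rfl | rfl | hw
  · simp
  · simp
  · have hlog : (-ENNReal.log w).toENNReal = ENNReal.ofReal (-Real.log w.toReal) := by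
      rw [ENNReal.log_pos_real' hw, ← EReal.coe_neg, EReal.real_coe_toENNReal]
    have hle : (min (-ENNReal.log w).toENNReal R).toReal ≤ max (-Real.log w.toReal) 0 := by
      rw [hlog]
      refine (ENNReal.toReal_mono ENNReal.ofReal_ne_top (min_le_left _ _)).trans ?_
      rw [ENNReal.toReal_ofReal']
    have hwt : w = ENNReal.ofReal w.toReal :=
      (ENNReal.ofReal_toReal (ENNReal.toReal_pos_iff.mp hw).2.ne).symm
    set t := w.toReal
    rw [hwt, ← ENNReal.ofReal_mul hw.le, ← ENNReal.ofReal_one,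
      ← ENNReal.ofReal_add zero_le_one hw.le]
    rw [← hwt]
    refine ENNReal.ofReal_le_ofReal ((mul_le_mul_of_nonneg_left (Real.exp_le_exp.mpr hle) hw.le).trans ?_)
    rcases le_total (-Real.log t) 0 with h | h
    · rw [max_eq_right h, Real.exp_zero]; linarith
    · rw [max_eq_left h, Real.exp_neg, Real.exp_log hw, mul_inv_cancel₀ hw.ne']; linarith

theorem isSzego_of_entropy
    (hent : ∀ h : Circle → ℝ, Continuous h →
      ∫ z, h z ∂circleLebesgue ≤ C + ∫ z, Real.exp (h z) ∂σ) : IsSzego σ := by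
  set w := σ.rnDeriv circleLebesgue with hw
  have hwm : Measurable w := Measure.measurable_rnDeriv _ _
  set u : Circle → ℝ≥0∞ := fun z => (-ENNReal.log (w z)).toENNReal with hu
  have hum : Measurable u :=
    measurable_ereal_toENNReal.comp (ENNReal.measurable_log.comp hwm).neg
  have hbound : ∀ R : ℕ, ∫⁻ z, min (u z) R ∂circleLebesgue ≤ ENNReal.ofReal (C + 3) := by
    intro R
    obtain ⟨s, hs, hs1, hs2⟩ := Measure.mutuallySingular_singularPart σ circleLebesgue
    set k : Circle → ℝ := fun z => (min (u z) R).toReal with hk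
    have hkm : Measurable k := (hum.min measurable_const).ennreal_toReal
    have hfin : ∀ z, min (u z) (R : ℝ≥0∞) ≠ ∞ := fun z =>
      ((min_le_right _ _).trans_lt (ENNReal.natCast_lt_top R)).ne
    have hkR : ∀ z, k z ≤ R := fun z => by
      have := ENNReal.toReal_mono (ENNReal.natCast_ne_top R) (min_le_right (u z) R)
      simpa using this
    have hk0 : ∀ z, 0 ≤ k z := fun z => ENNReal.toReal_nonneg
    -- The set `s` has full `m`-measure and is null for the singular part, so cutting off to `s`
    -- leaves the left side unchanged and makes `exp h = 1` almost everywhere for the singular part.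
    -- The bound `3` below is `1` from the singular part plus `2` from the absolutely continuous
    -- part.
    set h : Circle → ℝ := s.indicator k with hh
    have hhm : Measurable h := hkm.indicator hs
    have hh0 : ∀ z, 0 ≤ h z := fun z => Set.indicator_nonneg (fun z _ => hk0 z) z
    have hhk : ∀ z, h z ≤ k z := fun z => Set.indicator_le_self' (fun z _ => hk0 z) z
    have hmain := entropy_of_measurable hent hhm hh0 fun z => (hhk z).trans (hkR z)
    have hae : h =ᵐ[circleLebesgue] k := by
      filter_upwards [(compl_mem_ae_iff.mpr hs2 : sᶜᶜ ∈ ae circleLebesgue)] with z hz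
      rw [compl_compl] at hz
      exact Set.indicator_of_mem hz k
    rw [integral_congr_ae hae] at hmain
    have hexp : ∫ z, Real.exp (h z) ∂σ ≤ 3 := by
      rw [integral_eq_lintegral_of_nonneg_ae (Eventually.of_forall fun z => (Real.exp_pos _).le)
        (by fun_prop)]
      refine ENNReal.toReal_le_of_le_ofReal (by norm_num) ?_
      rw [← Measure.singularPart_add_rnDeriv σ circleLebesgue, lintegral_add_measure]
      have h1 : ∫⁻ z, ENNReal.ofReal (Real.exp (h z)) ∂σ.singularPart circleLebesgue ≤ 1 := by
        have : ∀ᵐ z ∂σ.singularPart circleLebesgue, ENNReal.ofReal (Real.exp (h z)) = 1 := by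
          filter_upwards [compl_mem_ae_iff.mpr hs1] with z hz
          rw [hh, Set.indicator_of_notMem hz, Real.exp_zero, ENNReal.ofReal_one]
        rw [lintegral_congr_ae this, lintegral_one]
        exact (Measure.singularPart_le σ circleLebesgue Set.univ).trans prob_le_one
      have h2 : ∫⁻ z, ENNReal.ofReal (Real.exp (h z)) ∂circleLebesgue.withDensity w ≤ 1 + 1 := by
        rw [lintegral_withDensity_eq_lintegral_mul _ hwm (by fun_prop)]
        calc ∫⁻ z, (w * fun z => ENNReal.ofReal (Real.exp (h z))) z ∂circleLebesgue
            ≤ ∫⁻ z, (1 + w z) ∂circleLebesgue := lintegral_mono fun z =>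
              (mul_le_mul_right (ENNReal.ofReal_le_ofReal (Real.exp_le_exp.mpr (hhk z))) _).trans
                (ofReal_exp_mul_le (w z) R)
          _ = 1 + ∫⁻ z, w z ∂circleLebesgue := by
              rw [lintegral_add_left measurable_const, lintegral_one, measure_univ]
          _ ≤ 1 + 1 := by
              gcongr
              exact Measure.lintegral_rnDeriv_le.trans prob_le_one
      refine (add_le_add h1 h2).trans ?_
      rw [show (3 : ℝ) = 1 + (1 + 1) by norm_num, ENNReal.ofReal_add, ENNReal.ofReal_add] <;>
        norm_num
    have hconv : ∫⁻ z, min (u z) R ∂circleLebesgue = ENNReal.ofReal (∫ z, k z ∂circleLebesgue) := by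
      rw [ofReal_integral_eq_lintegral_ofReal _ (Eventually.of_forall hk0)]
      · exact lintegral_congr fun z => (ENNReal.ofReal_toReal (hfin z)).symm
      · exact Integrable.of_bound hkm.aestronglyMeasurable R (Eventually.of_forall fun z => by
          rw [Real.norm_eq_abs, abs_of_nonneg (hk0 z)]; exact hkR z)
    rw [hconv]
    exact ENNReal.ofReal_le_ofReal (by linarith)
  -- The bound is uniform in `R`, so monotone convergence removes the truncation.
  have hsup : ∀ z, u z = ⨆ R : ℕ, min (u z) R := fun z => by
    rw [← inf_iSup_eq (u z) (fun R : ℕ => (R : ℝ≥0∞)), ENNReal.iSup_natCast, inf_top_eq]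
  have : ∫⁻ z, u z ∂circleLebesgue ≤ ENNReal.ofReal (C + 3) := by
    rw [lintegral_congr hsup, lintegral_iSup (fun R => hum.min measurable_const)
      fun a b hab z => min_le_min_left _ (by exact_mod_cast hab)]
    exact iSup_le hbound
  exact this.trans_lt ENNReal.ofReal_lt_top

end Entropy

/-! ### Lower bounds for integrals through polynomial approximation. -/

section Concentration

/-- Continuous functions on the circle are uniformly approximated by trigonometric polynomials. -/
lemma exists_polynomial_norm_sub_le {g : Circle → ℂ} (hg : Continuous g) :
    ∃ (p : ℂ[X]) (m : ℕ), ∀ z : Circle, ‖p.eval (z : ℂ) - (z : ℂ) ^ m * g z‖ ≤ 1 := by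
  let G : C(UnitAddCircle, ℂ) :=
    ⟨fun x => g (AddCircle.toCircle x), hg.comp AddCircle.continuous_toCircle⟩
  have hG : G ∈ (Submodule.span ℂ (Set.range (@fourier 1))).topologicalClosure := by
    rw [span_fourier_closure_eq_top]; trivial
  obtain ⟨T, hT, hTG⟩ := Metric.mem_closure_iff.mp hG 1 one_pos
  have hpoly : ∃ (p : ℂ[X]) (m : ℕ), ∀ x : UnitAddCircle,
      p.eval (AddCircle.toCircle x : ℂ) = (AddCircle.toCircle x : ℂ) ^ m * T x := by
    clear hTG
    induction hT using Submodule.span_induction with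
    | mem T hT =>
      obtain ⟨n, rfl⟩ := hT
      -- Multiplying by `z ^ |n|` clears a negative frequency.
      refine ⟨Polynomial.X ^ (n + n.natAbs).toNat, n.natAbs, fun x => ?_⟩
      have h0 : (AddCircle.toCircle x : ℂ) ≠ 0 := Circle.coe_ne_zero _
      rw [Polynomial.eval_pow, Polynomial.eval_X, fourier_apply, AddCircle.toCircle_zsmul,
        Circle.coe_zpow, ← zpow_natCast, ← zpow_natCast, ← zpow_add₀ h0]
      congr 1
      omega
    | zero => exact ⟨0, 0, fun x => by simp⟩
    | add T₁ T₂ _ _ h₁ h₂ =>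
      obtain ⟨p₁, m₁, h₁⟩ := h₁
      obtain ⟨p₂, m₂, h₂⟩ := h₂
      refine ⟨Polynomial.X ^ m₂ * p₁ + Polynomial.X ^ m₁ * p₂, m₁ + m₂, fun x => ?_⟩
      simp only [Polynomial.eval_add, Polynomial.eval_mul, Polynomial.eval_pow, Polynomial.eval_X,
        h₁, h₂, ContinuousMap.add_apply]
      ring
    | smul a T _ h =>
      obtain ⟨p, m, h⟩ := h
      refine ⟨Polynomial.C a * p, m, fun x => ?_⟩
      simp only [Polynomial.eval_mul, Polynomial.eval_C, h, ContinuousMap.smul_apply, smul_eq_mul]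
      ring
  obtain ⟨p, m, hp⟩ := hpoly
  refine ⟨p, m, fun z => ?_⟩
  obtain ⟨x, rfl⟩ := (AddCircle.homeomorphCircle (T := 1) one_ne_zero).surjective z
  rw [AddCircle.homeomorphCircle_apply, hp, ← mul_sub, norm_mul, norm_pow, Circle.norm_coe, one_pow,
    one_mul, ← dist_eq_norm, dist_comm]
  exact (ContinuousMap.dist_apply_le_dist (f := G) (g := T) x).trans hTG.le

variable {σ : Measure Circle} [IsProbabilityMeasure σ]

/-- A lower bound for the mass of `g ^ 2` in terms of its value at `1`, for a measure with small
Christoffel–Darboux kernel at `1`. -/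
lemma sq_apply_one_le_integral {α : ℕ → ℝ} (hα : ∀ i, |α i| < 1) {N : ℕ}
    (h : ∀ n ≤ N, OrthogonalBelow σ (szegoPoly α n) n) {g : Circle → ℝ} (hg : Continuous g)
    {p : ℂ[X]} (hpN : p.natDegree ≤ N) {m : ℕ}
    (hp : ∀ z : Circle, ‖p.eval (z : ℂ) - (z : ℂ) ^ m * (g z : ℂ)‖ ≤ 1) {K : ℝ}
    (hK : ∑ n ∈ Finset.range (N + 1), ‖(szegoPoly α n).eval 1‖ ^ 2 /
        ∏ i ∈ Finset.range n, (1 - α i ^ 2) ≤ K) :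
    g 1 ^ 2 / 2 - 1 ≤ K * (2 * ∫ z, g z ^ 2 ∂σ + 2) := by
  have hmain := norm_sq_eval_one_le (probReal_univ) hα h hpN
  have hn : ∀ z : Circle, ‖(z : ℂ) ^ m * (g z : ℂ)‖ = |g z| := fun z => by
    rw [norm_mul, norm_pow, Circle.norm_coe, one_pow, one_mul, Complex.norm_real,
      Real.norm_eq_abs]
  have h1 : g 1 ^ 2 / 2 - 1 ≤ ‖p.eval 1‖ ^ 2 := by
    have ha := hp 1
    have hb := norm_sub_norm_le ((1 : Circle) ^ m * (g 1 : ℂ) : ℂ) (p.eval ((1 : Circle) : ℂ))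
    rw [hn, norm_sub_rev] at hb
    rw [Circle.coe_one] at ha hb
    have hc : |g 1| ≤ ‖p.eval 1‖ + 1 := by linarith
    have hd := pow_le_pow_left₀ (abs_nonneg _) hc 2
    rw [sq_abs] at hd
    nlinarith [sq_nonneg (‖p.eval 1‖ - 1)]
  have h2 : ∫ z : Circle, ‖p.eval (z : ℂ)‖ ^ 2 ∂σ ≤ 2 * ∫ z, g z ^ 2 ∂σ + 2 := by
    have : ∫ z, (2 * g z ^ 2 + 2) ∂σ = 2 * ∫ z, g z ^ 2 ∂σ + 2 := by
      rw [integral_add (integrable_of_continuous (by fun_prop)) (integrable_const _),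
        integral_const_mul]
      simp
    rw [← this]
    refine integral_mono (integrable_of_continuous (by fun_prop))
      (integrable_of_continuous (by fun_prop)) fun z => ?_
    have hb := norm_sub_norm_le (p.eval (z : ℂ)) ((z : ℂ) ^ m * (g z : ℂ))
    rw [hn] at hb
    have hc : ‖p.eval (z : ℂ)‖ ≤ |g z| + 1 := by linarith [hp z]
    have hd := pow_le_pow_left₀ (norm_nonneg _) hc 2
    have he := sq_abs (g z)
    simp only
    nlinarith [sq_nonneg (|g z| - 1)]
  have h3 : 0 ≤ ∫ z : Circle, ‖p.eval (z : ℂ)‖ ^ 2 ∂σ := integral_nonneg fun z => sq_nonneg _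
  have hK0 : 0 ≤ K := (Finset.sum_nonneg fun n _ => div_nonneg (sq_nonneg _)
    (prod_one_sub_sq_pos hα n).le).trans hK
  calc g 1 ^ 2 / 2 - 1 ≤ ‖p.eval 1‖ ^ 2 := h1
    _ ≤ _ := hmain
    _ ≤ K * ∫ z : Circle, ‖p.eval (z : ℂ)‖ ^ 2 ∂σ := by gcongr
    _ ≤ _ := by gcongr

end Concentration

/-! ### The block of coefficients that creates a peak at `1`. -/

section Bump

/-- The Verblunsky coefficients `α 0, …, α (N - 1)`, continued so that `|Φ j 1|` rises
until `j = N + r` and decays afterwards, at the rate `1 / (A + |j - N - r|)`. -/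
noncomputable def bump (α : ℕ → ℝ) (N r : ℕ) (A : ℝ) (j : ℕ) : ℝ :=
  if j < N then α j
  else if j < N + r then -(1 / (A + (N + r - 1 - j : ℕ)))
  else 1 / (A + (j - (N + r) : ℕ) + 1)

variable {α : ℕ → ℝ} {N r : ℕ} {A : ℝ}

lemma bump_of_lt {j : ℕ} (hj : j < N) : bump α N r A j = α j := if_pos hj

lemma bump_rise {i : ℕ} (hi : i < r) : bump α N r A (N + i) = -(1 / (A + (r - 1 - i : ℕ))) := by
  rw [bump, if_neg (by omega), if_pos (by omega), show N + r - 1 - (N + i) = r - 1 - i by omega]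

lemma bump_decay (i : ℕ) : bump α N r A (N + r + i) = 1 / (A + i + 1) := by
  rw [bump, if_neg (by omega), if_neg (by omega), show N + r + i - (N + r) = i by omega]

lemma abs_bump_lt_one (hα : ∀ i, |α i| < 1) (hA : 2 ≤ A) (j : ℕ) : |bump α N r A j| < 1 := by
  unfold bump
  split_ifs
  · exact hα j
  · have h0 : (0 : ℝ) ≤ (N + r - 1 - j : ℕ) := Nat.cast_nonneg _
    rw [abs_neg, abs_of_nonneg (by positivity), div_lt_one (by linarith)]
    linarith
  · have h0 : (0 : ℝ) ≤ (j - (N + r) : ℕ) := Nat.cast_nonneg _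
    rw [abs_of_nonneg (by positivity), div_lt_one (by linarith)]
    linarith

/-- Telescoping via `1 / x ^ 2 ≤ 1 / (x - 1) - 1 / x`. -/
lemma sum_one_div_add_sq_le (hA : 2 ≤ A) (k : ℕ) :
    ∑ i ∈ Finset.range k, (1 / (A + i)) ^ 2 ≤ 2 / A := by
  have h : ∑ i ∈ Finset.range k, (1 / (A + i)) ^ 2 ≤ 1 / (A - 1) - 1 / (A + k - 1) := by
    induction k with
    | zero => simp
    | succ k ih =>
      rw [Finset.sum_range_succ]
      have hk : (0 : ℝ) ≤ k := Nat.cast_nonneg k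
      have : (1 / (A + k)) ^ 2 ≤ 1 / (A + k - 1) - 1 / (A + k) := by
        rw [div_sub_div _ _ (by linarith) (by linarith), div_pow,
          div_le_div_iff₀ (by positivity) (by nlinarith)]
        nlinarith
      push_cast
      rw [show A + ((k : ℝ) + 1) - 1 = A + k by ring]
      linarith
  have hk : (0 : ℝ) ≤ k := Nat.cast_nonneg k
  have h1 : 0 ≤ 1 / (A + k - 1) := div_nonneg zero_le_one (by linarith)
  have h2 : 1 / (A - 1) ≤ 2 / A := by
    rw [div_le_div_iff₀ (by linarith) (by linarith)]; linarith
  linarith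

lemma sum_one_div_add_succ_sq_le (hA : 2 ≤ A) (k : ℕ) :
    ∑ i ∈ Finset.range k, (1 / (A + i + 1)) ^ 2 ≤ 2 / A := by
  refine (Finset.sum_le_sum fun i _ => ?_).trans (sum_one_div_add_sq_le hA k)
  have hi : (0 : ℝ) ≤ i := Nat.cast_nonneg i
  exact pow_le_pow_left₀ (by positivity)
    (one_div_le_one_div_of_le (by positivity) (by linarith)) 2

/-- The cost `4 / A` depends neither on the height of the peak nor on the length of the tail. -/
lemma sum_bump_sq_le (hA : 2 ≤ A) (t : ℕ) :
    ∑ j ∈ Finset.range (N + r + t), bump α N r A j ^ 2 ≤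
      ∑ j ∈ Finset.range N, α j ^ 2 + 4 / A := by
  rw [Finset.sum_range_add, Finset.sum_range_add]
  have h1 : ∑ j ∈ Finset.range N, bump α N r A j ^ 2 = ∑ j ∈ Finset.range N, α j ^ 2 :=
    Finset.sum_congr rfl fun j hj => by rw [bump_of_lt (Finset.mem_range.mp hj)]
  have h2 : ∑ i ∈ Finset.range r, bump α N r A (N + i) ^ 2 =
      ∑ i ∈ Finset.range r, (1 / (A + i)) ^ 2 := by
    rw [← Finset.sum_range_reflect (fun i : ℕ => (1 / (A + i)) ^ 2)]
    refine Finset.sum_congr rfl fun i hi => ?_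
    rw [bump_rise (Finset.mem_range.mp hi), neg_sq]
  have h3 : ∑ i ∈ Finset.range t, bump α N r A (N + r + i) ^ 2 =
      ∑ i ∈ Finset.range t, (1 / (A + i + 1)) ^ 2 :=
    Finset.sum_congr rfl fun i _ => by rw [bump_decay]
  rw [h1, h2, h3, show 4 / A = 2 / A + 2 / A by ring]
  linarith [sum_one_div_add_sq_le hA r, sum_one_div_add_succ_sq_le hA t]

/-- Each factor is `(x + 1) / x`, with `x` stepping down to `A`, so the product telescopes; the
decaying half telescopes in the same way. -/
lemma prod_bump_rise (hA : 2 ≤ A) {i : ℕ} (hi : i ≤ r) :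
    ∏ j ∈ Finset.range (N + i), (1 - bump α N r A j) =
      (∏ j ∈ Finset.range N, (1 - α j)) * (A + r) / (A + (r - i : ℕ)) := by
  induction i with
  | zero =>
    have hr : (0 : ℝ) ≤ r := Nat.cast_nonneg r
    rw [add_zero, Nat.sub_zero, mul_div_cancel_right₀ _ (by linarith)]
    exact Finset.prod_congr rfl fun j hj => by rw [bump_of_lt (Finset.mem_range.mp hj)]
  | succ i ih =>
    rw [← add_assoc, Finset.prod_range_succ, ih (by omega), bump_rise (by omega)]
    obtain ⟨d, rfl⟩ : ∃ d, r = i + 1 + d := ⟨r - (i + 1), by omega⟩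
    rw [show i + 1 + d - i = d + 1 by omega, show i + 1 + d - 1 - i = d by omega,
      show i + 1 + d - (i + 1) = d by omega]
    have hd : (0 : ℝ) ≤ d := Nat.cast_nonneg d
    push_cast
    have h1 : A + d ≠ 0 := by positivity
    have h2 : A + (d + 1) ≠ 0 := by positivity
    field_simp
    ring

lemma prod_bump_decay (hA : 2 ≤ A) (i : ℕ) :
    ∏ j ∈ Finset.range (N + r + i), (1 - bump α N r A j) =
      (∏ j ∈ Finset.range N, (1 - α j)) * (A + r) / (A + i) := by
  induction i with
  | zero =>
    have := prod_bump_rise (α := α) (N := N) hA (le_refl r)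
    simpa using this
  | succ i ih =>
    rw [← add_assoc, Finset.prod_range_succ, ih, bump_decay]
    have hd : (0 : ℝ) ≤ i := Nat.cast_nonneg i
    push_cast
    have h1 : A + i ≠ 0 := by positivity
    have h2 : A + i + 1 ≠ 0 := by positivity
    rw [← add_assoc]
    field_simp
    ring

/-- The bound does not involve `t`. The tail can therefore be chosen after the polynomial at the
peak, as long as an approximation built from it requires. -/
lemma sum_prod_bump_sq_le (hA : 2 ≤ A) (t : ℕ) :
    ∑ n ∈ Finset.range (N + r + t), (∏ j ∈ Finset.range n, (1 - bump α N r A j)) ^ 2 ≤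
      ∑ n ∈ Finset.range N, (∏ j ∈ Finset.range n, (1 - α j)) ^ 2 +
        4 * A * ((∏ j ∈ Finset.range N, (1 - α j)) * (A + r) / A) ^ 2 := by
  rw [Finset.sum_range_add, Finset.sum_range_add]
  set Y := (∏ j ∈ Finset.range N, (1 - α j)) * (A + r) with hY
  have h1 : ∑ n ∈ Finset.range N, (∏ j ∈ Finset.range n, (1 - bump α N r A j)) ^ 2 =
      ∑ n ∈ Finset.range N, (∏ j ∈ Finset.range n, (1 - α j)) ^ 2 :=
    Finset.sum_congr rfl fun n hn => by
      congr 1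
      exact Finset.prod_congr rfl fun j hj => by
        rw [bump_of_lt ((Finset.mem_range.mp hj).trans (Finset.mem_range.mp hn))]
  have h2 : ∑ i ∈ Finset.range r, (∏ j ∈ Finset.range (N + i), (1 - bump α N r A j)) ^ 2 =
      Y ^ 2 * ∑ i ∈ Finset.range r, (1 / (A + i + 1)) ^ 2 := by
    rw [Finset.mul_sum, ← Finset.sum_range_reflect (fun i : ℕ => Y ^ 2 * (1 / (A + i + 1)) ^ 2)]
    refine Finset.sum_congr rfl fun i hi => ?_
    have hi' := Finset.mem_range.mp hi
    rw [prod_bump_rise hA hi'.le, ← hY, show r - i = r - 1 - i + 1 by omega]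
    push_cast
    rw [← add_assoc]
    ring
  have h3 : ∑ i ∈ Finset.range t, (∏ j ∈ Finset.range (N + r + i), (1 - bump α N r A j)) ^ 2 =
      Y ^ 2 * ∑ i ∈ Finset.range t, (1 / (A + i)) ^ 2 := by
    rw [Finset.mul_sum]
    refine Finset.sum_congr rfl fun i _ => ?_
    rw [prod_bump_decay hA, ← hY]
    ring
  rw [h1, h2, h3]
  have e2 := mul_le_mul_of_nonneg_left (sum_one_div_add_succ_sq_le hA r) (sq_nonneg Y)
  have e3 := mul_le_mul_of_nonneg_left (sum_one_div_add_sq_le hA t) (sq_nonneg Y)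
  have e4 : 4 * A * (Y / A) ^ 2 = Y ^ 2 * (2 / A) + Y ^ 2 * (2 / A) := by
    have : A ≠ 0 := by positivity
    field_simp
    ring
  linarith

lemma one_sub_sum_sq_le_prod {β : ℕ → ℝ} (hβ : ∀ i, |β i| < 1) (n : ℕ) :
    1 - ∑ i ∈ Finset.range n, β i ^ 2 ≤ ∏ i ∈ Finset.range n, (1 - β i ^ 2) := by
  have hle : ∀ n, ∏ i ∈ Finset.range n, (1 - β i ^ 2) ≤ 1 := fun n =>
    Finset.prod_le_one (fun i _ => by
      have := (sq_lt_one_iff_abs_lt_one (β i)).mpr (hβ i); linarith)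
      fun i _ => by linarith [sq_nonneg (β i)]
  induction n with
  | zero => simp
  | succ n ih =>
    rw [Finset.sum_range_succ, Finset.prod_range_succ]
    nlinarith [mul_le_mul_of_nonneg_right (hle n) (sq_nonneg (β n))]

end Bump

/-! ### Choosing the peaks and concatenating the blocks. -/

variable {F : ℝ≥0 → ℝ≥0}

lemma norm_sq_eval_one_szegoPoly (α : ℕ → ℝ) (n : ℕ) :
    ‖(szegoPoly α n).eval 1‖ ^ 2 = (∏ i ∈ Finset.range n, (1 - α i)) ^ 2 := by
  rw [eval_one_szegoPoly, Complex.norm_real, Real.norm_eq_abs, sq_abs]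

/-- Any finite string of real Verblunsky coefficients extends, at small cost, to a longer one
forcing `∫ F (|Φ n| ^ 2) ∂σ` to be large for some `n`. -/
lemma exists_bump (hcont : Continuous F)
    (hlim : Tendsto (fun x : ℝ≥0 => F x / x) atTop atTop) {α : ℕ → ℝ} (hα : ∀ i, |α i| < 1)
    (N : ℕ) {A B : ℝ} (hA : 2 ≤ A) (hB : 0 ≤ B) :
    ∃ r t : ℕ, 0 < t ∧ ∀ β : ℕ → ℝ, (∀ i < N + r + t, β i = bump α N r A i) →
      (∀ i, |β i| < 1) → (∀ n, 1 / 2 ≤ ∏ i ∈ Finset.range n, (1 - β i ^ 2)) →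
      ∀ σ : Measure Circle, IsProbabilityMeasure σ →
      (∀ n, OrthogonalBelow σ (szegoPoly β n) n) →
      B ≤ ∫ z : Circle, (F (‖(szegoPoly β (N + r)).eval (z : ℂ)‖₊ ^ 2) : ℝ) ∂σ := by
  set p₀ := ∏ j ∈ Finset.range N, (1 - α j) with hp₀
  have hp₀pos : 0 < p₀ := Finset.prod_pos fun i _ => by
    have := (abs_lt.mp (hα i)).2; linarith
  set S := ∑ n ∈ Finset.range N, (∏ j ∈ Finset.range n, (1 - α j)) ^ 2
  -- With kernel bound `10 A Y ^ 2`, the inequality `g(1) ^ 2 / 2 - 1 ≤ 10 A Y ^ 2 (2 ∫ g ^ 2 + 2)`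
  -- forces `∫ g ^ 2 ≥ B` once `g(1) ^ 2 ≥ (40 A (B + 1) + 2) Y ^ 2`; the `+ 2` pays for the `- 1`.
  obtain ⟨x₀, hx₀⟩ := eventually_atTop.mp
    (hlim.eventually_ge_atTop (40 * A * (B + 1) + 2).toNNReal)
  -- `r` makes the peak height `Y` dominate the earlier kernel sum `S`, the threshold `x₀`, and `1`.
  obtain ⟨r, hr⟩ := exists_nat_ge (max 1 (max S x₀) * A / p₀)
  set Y := p₀ * (A + r) / A with hY
  have hYge : max 1 (max S x₀) ≤ Y := by
    rw [hY, le_div_iff₀ (by linarith)]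
    rw [div_le_iff₀ hp₀pos] at hr
    nlinarith
  have hY1 : 1 ≤ Y := (le_max_left _ _).trans hYge
  have hYS : S ≤ Y := (le_max_left _ _).trans ((le_max_right _ _).trans hYge)
  have hYx : (x₀ : ℝ) ≤ Y := (le_max_right _ _).trans ((le_max_right _ _).trans hYge)
  have hYsq : Y ≤ Y ^ 2 := by nlinarith
  have hval : ‖(szegoPoly (bump α N r A) (N + r)).eval 1‖ ^ 2 = Y ^ 2 := by
    have := prod_bump_decay (α := α) (N := N) (r := r) hA 0
    rw [Nat.cast_zero, add_zero, add_zero] at this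
    rw [norm_sq_eval_one_szegoPoly, this]
  set g : Circle → ℝ := fun z =>
    √(F (‖(szegoPoly (bump α N r A) (N + r)).eval (z : ℂ)‖₊ ^ 2) : ℝ) with hg
  have hgc : Continuous g := by
    refine (NNReal.continuous_coe.comp (hcont.comp ?_)).sqrt
    fun_prop
  have hgsq : ∀ z, g z ^ 2 =
      F (‖(szegoPoly (bump α N r A) (N + r)).eval (z : ℂ)‖₊ ^ 2) := fun z =>
    Real.sq_sqrt (NNReal.coe_nonneg _)
  have hg1 : (40 * A * (B + 1) + 2) * Y ^ 2 ≤ g 1 ^ 2 := by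
    rw [hgsq, Circle.coe_one]
    set x : ℝ≥0 := ‖(szegoPoly (bump α N r A) (N + r)).eval 1‖₊ ^ 2 with hx
    have hxY : (x : ℝ) = Y ^ 2 := by rw [hx, NNReal.coe_pow, coe_nnnorm, hval]
    have hxx₀ : x₀ ≤ x := by rw [← NNReal.coe_le_coe, hxY]; linarith
    have h1 := NNReal.coe_le_coe.mpr (hx₀ x hxx₀)
    rw [Real.coe_toNNReal _ (by positivity), NNReal.coe_div, hxY,
      le_div_iff₀ (by positivity)] at h1
    exact h1
  obtain ⟨p, m, hp⟩ := exists_polynomial_norm_sub_le (Complex.continuous_ofReal.comp hgc)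
  -- This `t` prescribes every coefficient entering the kernel up to index `N + r + deg p`, and `p`
  -- is built from the peak polynomial alone.
  refine ⟨r, p.natDegree + 1, Nat.succ_pos _, fun β hβ hβ1 hβprod σ hσ horth => ?_⟩
  have hK : ∑ n ∈ Finset.range (N + r + p.natDegree + 1), ‖(szegoPoly β n).eval 1‖ ^ 2 /
      ∏ i ∈ Finset.range n, (1 - β i ^ 2) ≤ 10 * A * Y ^ 2 := by
    have h1 := sum_prod_bump_sq_le (α := α) (N := N) (r := r) hA (p.natDegree + 1)
    have h2 : ∑ n ∈ Finset.range (N + r + p.natDegree + 1), ‖(szegoPoly β n).eval 1‖ ^ 2 /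
        ∏ i ∈ Finset.range n, (1 - β i ^ 2) ≤ ∑ n ∈ Finset.range (N + r + (p.natDegree + 1)),
          2 * (∏ j ∈ Finset.range n, (1 - bump α N r A j)) ^ 2 := by
      rw [add_assoc (N + r)]
      refine Finset.sum_le_sum fun n hn => ?_
      rw [szegoPoly_congr (β := bump α N r A) fun i hi =>
        hβ i (hi.trans (Finset.mem_range.mp hn)), norm_sq_eval_one_szegoPoly,
        div_le_iff₀ (by linarith [hβprod n])]
      nlinarith [hβprod n, sq_nonneg (∏ j ∈ Finset.range n, (1 - bump α N r A j))]
    rw [← Finset.mul_sum] at h2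
    nlinarith
  have hmain := sq_apply_one_le_integral hβ1 (fun n _ => horth n) hgc (by omega) hp hK
  have hint : ∫ z, g z ^ 2 ∂σ =
      ∫ z : Circle, (F (‖(szegoPoly β (N + r)).eval (z : ℂ)‖₊ ^ 2) : ℝ) ∂σ := by
    simp_rw [hgsq]
    rw [szegoPoly_congr (β := bump α N r A) fun i hi => hβ i (by omega)]
  rw [hint] at hmain
  by_contra! hlt
  have hAY : 0 < A * Y ^ 2 := by positivity
  have h1 := mul_lt_mul_of_pos_left hlt hAY
  nlinarith

/-- There are real Verblunsky coefficients of a Szegő measure for which `∫ F (|Φ n| ^ 2) ∂σ` is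
unbounded along a sequence. -/
theorem exists_verblunsky (hcont : Continuous F)
    (hlim : Tendsto (fun x : ℝ≥0 => F x / x) atTop atTop) :
    ∃ β : ℕ → ℝ, (∀ i, |β i| < 1) ∧ (∀ n, 1 / 2 ≤ ∏ i ∈ Finset.range n, (1 - β i ^ 2)) ∧
      ∃ M : ℕ → ℕ, StrictMono M ∧ ∀ σ : Measure Circle, IsProbabilityMeasure σ →
        (∀ n, OrthogonalBelow σ (szegoPoly β n) n) →
        ∀ k : ℕ, (k : ℝ) ≤ ∫ z : Circle, (F (‖(szegoPoly β (M k)).eval (z : ℂ)‖₊ ^ 2) : ℝ) ∂σ := by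
  -- A state is a sequence with the length of its frozen prefix. Stage `k` uses `A = 2 ^ (k + 4)`,
  -- hence costs `4 / A = 1 / 2 ^ (k + 2)`; the total stays below `1 / 2`.
  have hstep : ∀ (k : ℕ) (s : {α : ℕ → ℝ // ∀ i, |α i| < 1} × ℕ),
      ∃ (s' : {α : ℕ → ℝ // ∀ i, |α i| < 1} × ℕ) (n : ℕ), s.2 ≤ n ∧ n < s'.2 ∧
        (∀ i < s.2, s'.1.1 i = s.1.1 i) ∧
        ∑ i ∈ Finset.range s'.2, s'.1.1 i ^ 2 ≤
          ∑ i ∈ Finset.range s.2, s.1.1 i ^ 2 + 1 / 2 ^ (k + 2) ∧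
        ∀ β : ℕ → ℝ, (∀ i < s'.2, β i = s'.1.1 i) → (∀ i, |β i| < 1) →
          (∀ n, 1 / 2 ≤ ∏ i ∈ Finset.range n, (1 - β i ^ 2)) →
          ∀ σ : Measure Circle, IsProbabilityMeasure σ →
          (∀ n, OrthogonalBelow σ (szegoPoly β n) n) →
          (k : ℝ) ≤ ∫ z : Circle, (F (‖(szegoPoly β n).eval (z : ℂ)‖₊ ^ 2) : ℝ) ∂σ := by
    rintro k ⟨⟨α, hα⟩, N⟩
    have hA : (2 : ℝ) ≤ 2 ^ (k + 4) := by
      calc (2 : ℝ) = 2 ^ 1 := (pow_one 2).symm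
        _ ≤ 2 ^ (k + 4) := pow_le_pow_right₀ one_le_two (by omega)
    obtain ⟨r, t, ht, h⟩ := exists_bump hcont hlim hα N hA k.cast_nonneg
    refine ⟨⟨⟨bump α N r (2 ^ (k + 4)), abs_bump_lt_one hα hA⟩, N + r + t⟩, N + r,
      Nat.le_add_right _ _, Nat.lt_add_of_pos_right ht, fun i hi => bump_of_lt hi, ?_, h⟩
    refine (sum_bump_sq_le hA t).trans_eq ?_
    congr 1
    rw [pow_add, pow_add]
    field_simp
    norm_num
  choose next idx hidx using hstep
  let s : ℕ → {α : ℕ → ℝ // ∀ i, |α i| < 1} × ℕ := fun k =>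
    Nat.rec (⟨fun _ => 0, fun i => by simp⟩, 0) next k
  have hs : ∀ k, s (k + 1) = next k (s k) := fun k => rfl
  have hlt : ∀ k, (s k).2 < (s (k + 1)).2 := fun k =>
    (hidx k (s k)).1.trans_lt (hidx k (s k)).2.1
  have hmono : StrictMono fun k => (s k).2 := strictMono_nat_of_lt_succ hlt
  have hagree : ∀ {k l : ℕ}, k ≤ l → ∀ i < (s k).2, (s l).1.1 i = (s k).1.1 i := by
    intro k l hkl
    induction l, hkl using Nat.le_induction with
    | base => exact fun i _ => rfl
    | succ l hkl ih =>
      intro i hi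
      rw [hs, (hidx l (s l)).2.2.1 i (hi.trans_le (hmono.monotone hkl)), ih i hi]
  have hsum : ∀ k, ∑ i ∈ Finset.range (s k).2, (s k).1.1 i ^ 2 ≤ 1 / 2 - 1 / 2 ^ (k + 1) := by
    intro k
    induction k with
    | zero => simp [s]
    | succ k ih =>
      have h1 := (hidx k (s k)).2.2.2.1
      have h2 : (1 : ℝ) / 2 ^ (k + 1) = 1 / 2 ^ (k + 2) + 1 / 2 ^ (k + 2) := by
        rw [pow_succ _ (k + 1)]; field_simp; norm_num
      rw [hs]
      linarith
  -- The prefix frozen at stage `i + 1` is longer than `i`, so entry `i` is already final there.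
  set β : ℕ → ℝ := fun i => (s (i + 1)).1.1 i with hβ
  have hβs : ∀ k, ∀ i < (s k).2, β i = (s k).1.1 i := by
    intro k i hi
    rcases le_total k (i + 1) with h | h
    · exact hagree h i hi
    · exact (hagree h i ((hmono.id_le i).trans_lt (hlt i))).symm
  have hβ1 : ∀ i, |β i| < 1 := fun i => (s (i + 1)).1.2 i
  have hprod : ∀ n, 1 / 2 ≤ ∏ i ∈ Finset.range n, (1 - β i ^ 2) := by
    intro n
    have h1 : ∑ i ∈ Finset.range n, β i ^ 2 ≤ 1 / 2 := by
      calc ∑ i ∈ Finset.range n, β i ^ 2 ≤ ∑ i ∈ Finset.range (s n).2, β i ^ 2 :=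
            Finset.sum_le_sum_of_subset_of_nonneg (Finset.range_mono (hmono.id_le n))
              fun i _ _ => sq_nonneg _
        _ = ∑ i ∈ Finset.range (s n).2, (s n).1.1 i ^ 2 :=
            Finset.sum_congr rfl fun i hi => by rw [hβs n i (Finset.mem_range.mp hi)]
        _ ≤ 1 / 2 - 1 / 2 ^ (n + 1) := hsum n
        _ ≤ 1 / 2 := sub_le_self _ (by positivity)
    linarith [one_sub_sum_sq_le_prod hβ1 n]
  refine ⟨β, hβ1, hprod, fun k => idx k (s k), strictMono_nat_of_lt_succ fun k =>
    (hidx k (s k)).2.1.trans_le (hidx (k + 1) (s (k + 1))).1, fun σ hσ horth k => ?_⟩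
  exact (hidx k (s k)).2.2.2.2 β (fun i hi => hβs (k + 1) i hi) hβ1 hprod σ hσ horth

end OPUC

theorem corollary3p1 (F : ℝ≥0 → ℝ≥0) (hmono : Monotone F) (hcont : Continuous F)
    (hlim : Tendsto (fun x : ℝ≥0 => F x / x) atTop atTop) :
    ∃ σ : Measure Circle, IsProbabilityMeasure σ ∧ OPUC.IsSzego σ ∧
      ∃ Φ : ℕ → ℂ[X], OPUC.IsMonicOPUC σ Φ ∧
        ∃ M : ℕ → ℕ, StrictMono M ∧
          Tendsto (fun k => ∫ z : Circle, (F (‖(Φ (M k)).eval (z : ℂ)‖₊ ^ 2) : ℝ) ∂σ)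
            atTop atTop := by
  obtain ⟨β, hβ, hprod, M, hM, hlarge⟩ := OPUC.exists_verblunsky hcont hlim
  obtain ⟨σ, hσ, horth, hent⟩ := OPUC.exists_measure_of_verblunsky hβ one_half_pos hprod
  refine ⟨σ, hσ, OPUC.isSzego_of_entropy (C := -(1 + Real.log (1 / 2))) fun h hh => ?_,
    OPUC.szegoPoly β, ⟨OPUC.monic_szegoPoly β, OPUC.natDegree_szegoPoly β, horth⟩, M, hM,
    tendsto_atTop_mono (hlarge σ hσ horth) tendsto_natCast_atTop_atTop⟩
  linarith [hent h hh]
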